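/- All structures are smooth and real, and manifolds are finite-dimensional, Hausdorff and paracompact. Let $(P,\theta)$ be an exact symplectic manifold, i.e. $\theta\in\Omega^1(P)$ and $\omega=-\mathrm{d}\theta$ is non-degenerate, let $\nabla$ be its Liouville vector field, $\iota_\nabla\omega=\theta$, and let $h\in C^\infty(P)$. Let $G$ be a Lie group with Lie algebra $\mathfrak g$ and let $\Phi\colon G\times P\to P$ be a smooth action with $\Phi_g^*\theta=\theta$ and $h\circ\Phi_g=h$ for all $g\in G$. For a smooth action on a manifold $M$ and $\xi\in\mathfrak g$, write $\xi_M(p)=\frac{\mathrm d}{\mathrm dt}\big|_{t=0}\exp(t\xi)\cdot p$ for the fundamental vector field. Let $\mathbf J\colon P\to\mathfrak g^*$ be an exact symplectic momentum map, i.e. $\iota_{\xi_P}\theta=\langle\mathbf J,\xi\rangle$ for all $\xi\in\mathfrak g$. Let $c\in\mathbb R$ be a regular value of $h$, let $S=h^{-1}(c)$ with its structure of embedded submanifold, with inclusion $i\colon S\hookrightarrow P$, suppose that $\langle\nabla_x\rangle+\mathrm T_xS=\mathrm T_xP$ for all $x\in S$, and let $\eta=i^*\theta$ (so that $(S,\eta)$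 is an energy hypersurface of $(P,\theta,\nabla,h)$). Then there is a smooth action $\Phi^S\colon G\times S\to S$ with $i\circ\Phi^S_g=\Phi_g\circ i$ for all $g\in G$, and it is a contact Lie group action relative to $(S,\eta)$: $\eta$ is a contact form on $S$ (that is, $S$ has odd dimension $2m+1$ and $\eta\wedge(\mathrm d\eta)^m$ vanishes nowhere) and $(\Phi^S_g)^*\eta=\eta$ for all $g\in G$. Moreover, $\mathbf J\circ i\colon S\to\mathfrak g^*$ is a contact momentum map for $\Phi^S$ and $\eta$, i.e. $\iota_{\xi_S}\eta=\langle\mathbf J\circ i,\xi\rangle$ for all $\xi\in\mathfrak g$. -/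

import Mathlib

open Set Bundle Module
open scoped Manifold ContDiff Topology

noncomputable section

/-! Manifolds without boundary are modelled on finite-dimensional real normed spaces; the
smooth structure on `M` is given by `ChartedSpace E M` and `IsManifold 𝓘(ℝ, E) ∞ M`. -/

section DifferentialForms

variable {E : Type*} [NormedAddCommGroup E] [NormedSpace ℝ E]
  {M : Type*} [TopologicalSpace M] [ChartedSpace E M]

/-- A (not necessarily smooth) differential one-form: a covector at each point. -/
abbrev OneForm (E : Type*) [NormedAddCommGroup E] [NormedSpace ℝ E]
    (M : Type*) [TopologicalSpace M] [ChartedSpace E M] : Type _ :=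
  ∀ x : M, TangentSpace 𝓘(ℝ, E) x →L[ℝ] ℝ

/-- A (not necessarily smooth) vector field. -/
abbrev VecField (E : Type*) [NormedAddCommGroup E] [NormedSpace ℝ E]
    (M : Type*) [TopologicalSpace M] [ChartedSpace E M] : Type _ :=
  ∀ x : M, TangentSpace 𝓘(ℝ, E) x

/-- The one-form is a smooth section of the cotangent bundle. -/
def OneForm.IsSmooth [IsManifold 𝓘(ℝ, E) ∞ M] (θ : OneForm E M) : Prop :=
  ContMDiff 𝓘(ℝ, E) (𝓘(ℝ, E).prod 𝓘(ℝ, E →L[ℝ] ℝ)) ∞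
    (fun x : M => (TotalSpace.mk' (E →L[ℝ] ℝ)
      (E := fun x : M => TangentSpace 𝓘(ℝ, E) x →L[ℝ] Bundle.Trivial M ℝ x) x (θ x)))

/-- The vector field is a smooth section of the tangent bundle. -/
def VecField.IsSmooth [IsManifold 𝓘(ℝ, E) ∞ M] (X : VecField E M) : Prop :=
  ContMDiff 𝓘(ℝ, E) 𝓘(ℝ, E).tangent ∞ (fun x : M => (⟨x, X x⟩ : TangentBundle 𝓘(ℝ, E) M))

/-- The pullback `f^* θ` of a one-form. -/
def OneForm.pullback {E' : Type*} [NormedAddCommGroup E'] [NormedSpace ℝ E']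
    {N : Type*} [TopologicalSpace N] [ChartedSpace E' N]
    (f : N → M) (θ : OneForm E M) : OneForm E' N :=
  fun x => (θ (f x)).comp (mfderiv 𝓘(ℝ, E') 𝓘(ℝ, E) f x)

/-- The expression `(φ⁻¹)^* θ` of a one-form in the chart `φ` at `x`, as a differential form
of degree one on the model space (meaningful on the target of the chart). -/
def OneForm.inChart (θ : OneForm E M) (x : M) : E → E [⋀^Fin 1]→L[ℝ] ℝ :=
  fun y => ContinuousAlternatingMap.ofSubsingleton ℝ E ℝ (0 : Fin 1)
    ((θ ((chartAt E x).symm y)).comp (mfderiv 𝓘(ℝ, E) 𝓘(ℝ, E) (chartAt E x).symm y))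

/-- The exterior derivative `dθ` of a one-form, `(dθ)_x = φ^* (d ((φ⁻¹)^* θ))` at `x`, with `φ`
the chart at `x`. -/
def OneForm.extD (θ : OneForm E M) (x : M) : TangentSpace 𝓘(ℝ, E) x [⋀^Fin 2]→L[ℝ] ℝ :=
  (extDeriv (θ.inChart x) (chartAt E x x)).compContinuousLinearMap
    (mfderiv 𝓘(ℝ, E) 𝓘(ℝ, E) (chartAt E x) x)

end DifferentialForms

section Symplectic

variable {E : Type*} [NormedAddCommGroup E] [NormedSpace ℝ E]
  {P : Type*} [TopologicalSpace P] [ChartedSpace E P]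

/-- The two-form `ω = -dθ`. -/
def sympForm (θ : OneForm E P) (x : P) : TangentSpace 𝓘(ℝ, E) x [⋀^Fin 2]→L[ℝ] ℝ :=
  -(θ.extD x)

/-- `(P, θ)` is an exact symplectic manifold: `θ` is smooth and `ω = -dθ` is non-degenerate
(it is closed, being exact). -/
structure IsExactSymplectic [IsManifold 𝓘(ℝ, E) ∞ P] (θ : OneForm E P) : Prop where
  smooth : θ.IsSmooth
  nondegenerate : ∀ (x : P) (u : TangentSpace 𝓘(ℝ, E) x),
    (∀ v : TangentSpace 𝓘(ℝ, E) x, sympForm θ x ![u, v] = 0) → u = 0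

/-- `X` is the Liouville vector field of `(P, θ)`: `θ = ι_X ω`. -/
structure IsLiouvilleField [IsManifold 𝓘(ℝ, E) ∞ P] (θ : OneForm E P) (X : VecField E P) :
    Prop where
  smooth : X.IsSmooth
  contract : ∀ (x : P) (v : TangentSpace 𝓘(ℝ, E) x), θ x v = sympForm θ x ![X x, v]

/-- `(P, θ, X, h)` is an exact symplectic Hamiltonian system. -/
structure IsExactHamiltonianSystem [IsManifold 𝓘(ℝ, E) ∞ P]
    (θ : OneForm E P) (X : VecField E P) (h : P → ℝ) : Prop where
  exactSymplectic : IsExactSymplectic θ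
  liouville : IsLiouvilleField θ X
  smooth : ContMDiff 𝓘(ℝ, E) 𝓘(ℝ, ℝ) ∞ h

/-- `c` is a regular value of `h : P → ℝ`. -/
def IsRegularValue (h : P → ℝ) (c : ℝ) : Prop :=
  ∀ x : P, h x = c → Function.Surjective (mfderiv 𝓘(ℝ, E) 𝓘(ℝ, ℝ) h x)

/-- The vector field `X` is transverse to the submanifold `S` with inclusion `i : S → P`:
`⟨X_x⟩ + T_x S = T_x P` for all `x ∈ S`. -/
def IsTransverse {E' : Type*} [NormedAddCommGroup E'] [NormedSpace ℝ E']
    {S : Type*} [TopologicalSpace S] [ChartedSpace E' S]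
    (X : VecField E P) (i : S → P) : Prop :=
  ∀ x : S, Submodule.span ℝ {X (i x)} ⊔
    LinearMap.range (mfderiv 𝓘(ℝ, E') 𝓘(ℝ, E) i x).toLinearMap = ⊤

/-- `S = h⁻¹(c)`, with a given smooth structure, is the underlying submanifold of an energy
hypersurface: `c` is a regular value of `h`, the smooth structure is that of an embedded
submanifold of `P`, and the vector field `X` is transverse to it. -/
structure IsEnergyHypersurface {E' : Type*} [NormedAddCommGroup E'] [NormedSpace ℝ E']
    (X : VecField E P) (h : P → ℝ) (c : ℝ) [ChartedSpace E' (h ⁻¹' {c})] : Prop where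
  regular : IsRegularValue (E := E) h c
  embedded : Manifold.IsSmoothEmbedding 𝓘(ℝ, E') 𝓘(ℝ, E) ∞ (Subtype.val : h ⁻¹' {c} → P)
  transverse : IsTransverse (E' := E') X (Subtype.val : h ⁻¹' {c} → P)

end Symplectic

section Contact

/-- A positive multiple (depending only on normalisation conventions) of the form
`α ∧ β ∧ ⋯ ∧ β`, with `m` factors `β`, of a covector `α` and an alternating two-form `β`,
evaluated at `2 m + 1` vectors. -/
def wedgePow {V : Type*} [AddCommGroup V] [Module ℝ V] [TopologicalSpace V]
    (α : V →L[ℝ] ℝ) (β : V [⋀^Fin 2]→L[ℝ] ℝ) (m : ℕ) (v : Fin (2 * m + 1) → V) : ℝ :=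
  ∑ σ : Equiv.Perm (Fin (2 * m + 1)), ((Equiv.Perm.sign σ : ℤ) : ℝ) *
    (α (v (σ 0)) * ∏ i : Fin m,
      β ![v (σ ⟨2 * i.val + 1, by omega⟩), v (σ ⟨2 * i.val + 2, by omega⟩)])

/-- `η` is a (global) contact form on `M`: it is smooth, `M` has odd dimension `2 m + 1`, and
`η ∧ (dη)^m` is nowhere zero. The dimension is required at each point, so that nothing is asked
of the model space of an empty manifold. -/
structure IsContactForm {E : Type*} [NormedAddCommGroup E] [NormedSpace ℝ E]
    {M : Type*} [TopologicalSpace M] [ChartedSpace E M] [IsManifold 𝓘(ℝ, E) ∞ M]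
    (η : OneForm E M) : Prop where
  smooth : η.IsSmooth
  volume : ∀ x : M, ∃ m : ℕ, finrank ℝ (TangentSpace 𝓘(ℝ, E) x) = 2 * m + 1 ∧
    ∃ v : Fin (2 * m + 1) → TangentSpace 𝓘(ℝ, E) x, wedgePow (η x) (η.extD x) m v ≠ 0

end Contact

section Actions

variable {F : Type*} [NormedAddCommGroup F] [NormedSpace ℝ F]
  {G : Type*} [TopologicalSpace G] [ChartedSpace F G] [Group G]
  {E : Type*} [NormedAddCommGroup E] [NormedSpace ℝ E]
  {M : Type*} [TopologicalSpace M] [ChartedSpace E M]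

/-- Left-invariant vector fields on a Lie group are complete. -/
theorem exists_oneParameterSubgroup [CompleteSpace F] [T2Space G]
    [LieGroup 𝓘(ℝ, F) ∞ G] (ξ : GroupLieAlgebra 𝓘(ℝ, F) G) :
    ∃ γ : ℝ → G, γ 0 = 1 ∧ IsMIntegralCurve γ (mulInvariantVectorField ξ) := by
  have : LieGroup 𝓘(ℝ, F) (minSmoothness ℝ 3) G :=
    LieGroup.of_le (n := ∞) (by simpa using ENat.LEInfty.out)
  have hv : ContMDiff 𝓘(ℝ, F) 𝓘(ℝ, F).tangent 1
      (fun g : G => (⟨g, mulInvariantVectorField ξ g⟩ : TangentBundle 𝓘(ℝ, F) G)) :=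
    (contMDiff_mulInvariantVectorField ξ).of_le (by simp)
  obtain ⟨γ, h0, hγ⟩ := exists_isMIntegralCurveAt_of_contMDiffAt_boundaryless
    (t₀ := (0 : ℝ)) (hv.contMDiffAt (x := (1 : G)))
  obtain ⟨ε, hε, hγ⟩ := isMIntegralCurveAt_iff'.1 hγ
  refine exists_isMIntegralCurve_of_isMIntegralCurveOn hv hε (fun g => ?_) 1
  refine ⟨fun t => g * γ t, by simp [h0], fun t ht => ?_⟩
  have ht' : t ∈ Metric.ball (0 : ℝ) ε := by
    rwa [Real.ball_eq_Ioo, zero_sub, zero_add]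
  have hball : Metric.ball (0 : ℝ) ε ∈ 𝓝 t := Metric.isOpen_ball.mem_nhds ht'
  have h1 := (hγ t ht').hasMFDerivAt hball
  have hL : ∀ a b : G, MDifferentiableAt 𝓘(ℝ, F) 𝓘(ℝ, F) (fun x : G => a * x) b := fun a b =>
    (contMDiff_mul_left (I := 𝓘(ℝ, F)) (n := ∞) (a := a)).contMDiffAt.mdifferentiableAt (by simp)
  have h2 := (hL g (γ t)).hasMFDerivAt.comp t h1
  have h3 : mfderiv 𝓘(ℝ, F) 𝓘(ℝ, F) (fun x : G => g * x) (γ t)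
      (mulInvariantVectorField ξ (γ t)) = mulInvariantVectorField ξ (g * γ t) := by
    have hD : (fun x : G => g * γ t * x) = (fun x => g * x) ∘ (fun x => γ t * x) := by
      ext x; simp [mul_assoc]
    simp only [mulInvariantVectorField]
    rw [hD, mfderiv_comp (I' := 𝓘(ℝ, F)) (1 : G) (hL _ _) (hL _ _), mul_one]
    rfl
  refine HasMFDerivAt.hasMFDerivWithinAt ?_
  have h4 : (mfderiv 𝓘(ℝ, F) 𝓘(ℝ, F) (fun x : G => g * x) (γ t)).comp
      ((1 : ℝ →L[ℝ] ℝ).smulRight (mulInvariantVectorField ξ (γ t))) =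
      (1 : ℝ →L[ℝ] ℝ).smulRight (mulInvariantVectorField ξ (g * γ t)) := by
    rw [← h3]
    ext
    simp
  exact h4 ▸ h2

/-- The one-parameter subgroup generated by `ξ`: the integral curve through `1` of the
left-invariant vector field of `ξ`. -/
def oneParameterSubgroup [CompleteSpace F] [T2Space G]
    [LieGroup 𝓘(ℝ, F) ∞ G] (ξ : GroupLieAlgebra 𝓘(ℝ, F) G) : ℝ → G :=
  (exists_oneParameterSubgroup ξ).choose

/-- The exponential map of a Lie group. -/
def lieExp [CompleteSpace F] [T2Space G]
    [LieGroup 𝓘(ℝ, F) ∞ G] (ξ : GroupLieAlgebra 𝓘(ℝ, F) G) : G :=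
  oneParameterSubgroup ξ 1

/-- The fundamental vector field `ξ_M(p) = d/dt|_{t=0} (exp(tξ) • p)`. The curve passes through
`p` at `t = 0`; the ascription identifies the tangent space at `exp(0ξ) • p` with that at `p`. -/
def fundamentalField [CompleteSpace F] [T2Space G] [LieGroup 𝓘(ℝ, F) ∞ G] [MulAction G M]
    (ξ : GroupLieAlgebra 𝓘(ℝ, F) G) : VecField E M :=
  fun p => (mfderiv 𝓘(ℝ, ℝ) 𝓘(ℝ, E) (fun t : ℝ => lieExp (t • ξ) • p) 0 (1 : ℝ) : E)

/-- The action of `G` leaves the one-form `θ` invariant: `Φ_g^* θ = θ` for all `g`. -/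
def IsInvariantForm (G : Type*) [Group G] [MulAction G M] (θ : OneForm E M) : Prop :=
  ∀ g : G, OneForm.pullback (fun x : M => g • x) θ = θ

/-- `J : M → 𝔤^*` is a momentum map for the one-form `θ` and the action of `G` on `M`:
`ι_{ξ_M} θ = ⟨J, ξ⟩` for all `ξ ∈ 𝔤`. It is an exact symplectic momentum map when `(M, θ)` is an
exact symplectic manifold and a contact momentum map when `(M, θ)` is a contact manifold.
Since `𝔤` is finite-dimensional, smoothness of `J` means smoothness of all `⟨J, ξ⟩`. -/
structure IsMomentumMap [CompleteSpace F] [T2Space G] [LieGroup 𝓘(ℝ, F) ∞ G] [MulAction G M]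
    (θ : OneForm E M) (J : M → Module.Dual ℝ (GroupLieAlgebra 𝓘(ℝ, F) G)) : Prop where
  smooth : ∀ ξ : GroupLieAlgebra 𝓘(ℝ, F) G, ContMDiff 𝓘(ℝ, E) 𝓘(ℝ, ℝ) ∞ (fun p => J p ξ)
  contract : ∀ (ξ : GroupLieAlgebra 𝓘(ℝ, F) G) (p : M), θ p (fundamentalField ξ p) = J p ξ

/-- The action of `G` on `M` is a contact Lie group action relative to `(M, η)`: `η` is a contact
form, the action is smooth and preserves `η`. -/
structure IsContactAction (F : Type*) [NormedAddCommGroup F] [NormedSpace ℝ F]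
    (G : Type*) [TopologicalSpace G] [ChartedSpace F G] [Group G] [MulAction G M]
    [IsManifold 𝓘(ℝ, E) ∞ M] (η : OneForm E M) : Prop where
  contact : IsContactForm η
  smooth : ContMDiffSMul 𝓘(ℝ, F) 𝓘(ℝ, E) ∞ G M
  invariant : IsInvariantForm G η

end Actions

end

/-!
An energy hypersurface `S = h⁻¹(c)` transverse to the Liouville field `X` is of contact type, and
everything `G`-equivariant on `P` restricts to it.

The action preserves `h`, hence `S`. The restricted action is smooth because `S` is embedded: a
continuous map into `S` is smooth as soon as its composition with the inclusion `i` is. Since `i`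
is equivariant, `η = i^* θ` is invariant (`IsInvariantForm.pullback`) and `i` relates the
fundamental vector fields of `S` and `P` (`mfderiv_fundamentalField`), so that `J ∘ i` is a momentum
map (`IsMomentumMap.pullback`). The differentiability of `t ↦ exp (t ξ)` needed for the chain rule
comes from `exp (t ξ) = γ_ξ(t)` (`lieExp_smul`).

For the contact condition, naturality of the exterior derivative (`OneForm.IsSmooth.extD_pullback`)
gives `dη = i^* dθ`, which reduces the claim to linear algebra at a point
(`exists_wedgePow_pullback_ne_zero`). The image of `T_x S` is the hyperplane `ker dh` of the
symplectic space `(T_x P, ω)`, with `X` outside it. The vector `r` with `ι_r ω` proportional to `dh`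
lies in the hyperplane, is annihilated by `ω` there, and can be normalised by `η(r) = 1` as
`dh(X) ≠ 0`. The symplectic complement of the plane spanned by `X` and `r` is `ker η` in `T_x S`; it
is symplectic and has a symplectic basis of `2 m` vectors. On `r` followed by this basis,
`η ∧ (dη)^m` is a sum over permutations of nonnegative terms, that of the identity being `1`
(`exists_wedgePow_ne_zero`).
-/

/-! ### Symplectic linear algebra -/

section LinearAlgebra

variable {V : Type*} [AddCommGroup V] [Module ℝ V] {B : V →ₗ[ℝ] V →ₗ[ℝ] ℝ}

theorem LinearMap.IsAlt.finrank_ker_inf_ker_add_two [FiniteDimensional ℝ V] (hB : B.IsAlt)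
    {u v : V} (huv : B u v ≠ 0) :
    finrank ℝ (LinearMap.ker (B u) ⊓ LinearMap.ker (B v) : Submodule ℝ V) + 2 = finrank ℝ V := by
  have hvu : B v u ≠ 0 := by rw [← hB.neg]; exact neg_ne_zero.2 huv
  have hsurj : LinearMap.range ((B u).prod (B v)) = ⊤ := by
    refine LinearMap.range_eq_top.2 fun y => ⟨(y.2 / B v u) • u + (y.1 / B u v) • v, ?_⟩
    ext <;> simp [hB.self_eq_zero, huv, hvu]
  have key := ((B u).prod (B v)).finrank_range_add_finrank_ker
  rw [hsurj, finrank_top, LinearMap.ker_prod, finrank_prod, finrank_self] at key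
  omega

/-- The symplectic complement of a hyperbolic plane is a symplectic subspace. -/
theorem LinearMap.IsAlt.eq_zero_of_mem_ker_inf_ker (hB : B.IsAlt)
    (hnd : ∀ u, (∀ v, B u v = 0) → u = 0) {u v : V} (huv : B u v ≠ 0)
    {w : V} (hw : w ∈ LinearMap.ker (B u) ⊓ LinearMap.ker (B v))
    (h : ∀ w' ∈ LinearMap.ker (B u) ⊓ LinearMap.ker (B v), B w w' = 0) : w = 0 := by
  have hvu : B v u = -B u v := (hB.neg u v).symm
  have hwu : B w u = 0 := by rw [← hB.neg, hw.1, neg_zero]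
  have hwv : B w v = 0 := by rw [← hB.neg, hw.2, neg_zero]
  refine hnd w fun x => ?_
  -- `B w` vanishes on the remainder of `x` after projecting to the plane spanned by `u` and `v`.
  have hx := h (x + (B v x / B u v) • u - (B u x / B u v) • v) ⟨?_, ?_⟩
  · simpa [hwu, hwv] using hx
  · simp [hB.self_eq_zero, huv]
  · simp [hB.self_eq_zero, huv, hvu]

/-- A symplectic vector space has a symplectic basis; linear independence of the family follows
from the relations and is not stated. -/
theorem LinearMap.IsAlt.exists_symplectic_basis [FiniteDimensional ℝ V] (hB : B.IsAlt)
    (hnd : ∀ u, (∀ v, B u v = 0) → u = 0) :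
    ∃ (m : ℕ) (e f : Fin m → V), finrank ℝ V = 2 * m ∧ (∀ i j, B (e i) (e j) = 0) ∧
      (∀ i j, B (f i) (f j) = 0) ∧ ∀ i j, B (e i) (f j) = if i = j then 1 else 0 := by
  induction hn : finrank ℝ V using Nat.strong_induction_on generalizing V with
  | _ n ih =>
    rcases subsingleton_or_nontrivial V with hV | hV
    · refine ⟨0, Fin.elim0, Fin.elim0, ?_, fun i => i.elim0, fun i => i.elim0, fun i => i.elim0⟩
      rw [← hn, finrank_zero_of_subsingleton]
    obtain ⟨u, hu⟩ := exists_ne (0 : V)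
    obtain ⟨v₀, hv₀⟩ : ∃ v, B u v ≠ 0 := by
      by_contra! hall
      exact hu (hnd u hall)
    obtain ⟨v, huv⟩ : ∃ v, B u v = 1 := ⟨(B u v₀)⁻¹ • v₀, by simp [hv₀]⟩
    have huv' : B u v ≠ 0 := by simp [huv]
    have hdim := hB.finrank_ker_inf_ker_add_two huv'
    set W := LinearMap.ker (B u) ⊓ LinearMap.ker (B v) with hW
    obtain ⟨m, e, f, hm, hee, hff, hef⟩ := ih (finrank ℝ W) (by omega)
      (B := B.domRestrict₁₂ W W) (fun w => hB w)
      (fun w hw => Subtype.ext <| hB.eq_zero_of_mem_ker_inf_ker hnd huv' w.2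
        fun w' hw' => hw ⟨w', hw'⟩) rfl
    have h1 : ∀ w : W, B u w = 0 := fun w => w.2.1
    have h2 : ∀ w : W, B v w = 0 := fun w => w.2.2
    have h3 : ∀ w : W, B w u = 0 := fun w => by rw [← hB.neg, h1, neg_zero]
    have h4 : ∀ w : W, B w v = 0 := fun w => by rw [← hB.neg, h2, neg_zero]
    simp only [LinearMap.domRestrict₁₂_apply] at hee hff hef
    refine ⟨m + 1, Fin.cons u fun i => e i, Fin.cons v fun i => f i, by omega, ?_, ?_, ?_⟩ <;>
    · intro i j
      cases i using Fin.cases <;> cases j using Fin.cases <;>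
        simp [hB.self_eq_zero, huv, h1, h2, h3, h4, hee, hff, hef, Fin.succ_ne_zero,
          (Fin.succ_ne_zero _).symm]

end LinearAlgebra

/-! ### Top-degree wedge powers -/

section WedgePow

open Equiv

/-- The standard symplectic matrix `[[0, 1], [-1, 0]]` on one hyperbolic pair. -/
def hyperbolicSign (b c : Fin 2) : ℝ := if b = c then 0 else if b = 0 then 1 else -1

theorem hyperbolicSign_perm (s : Perm (Fin 2)) :
    hyperbolicSign (s 0) (s 1) = ((Perm.sign s : ℤ) : ℝ) := by
  have hs : s 0 ≠ s 1 := s.injective.ne (by decide)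
  have hsign : ∀ s : Perm (Fin 2), (Perm.sign s : ℤ) = if s 0 = 0 then 1 else -1 := by decide
  rw [hsign, hyperbolicSign, if_neg hs]
  split_ifs <;> simp

/-- Each nonzero term of the Pfaffian of the standard symplectic matrix equals `1`: the
permutation `ρ` permutes the hyperbolic pairs, which contributes an even permutation, and acts
within each of them, which contributes the same sign to `sign ρ` and to the product. -/
theorem sign_mul_prod_hyperbolicSign_nonneg {m : ℕ} (ρ : Perm (Fin m × Fin 2)) :
    0 ≤ ((Perm.sign ρ : ℤ) : ℝ) * ∏ i, (if (ρ (i, 0)).1 = (ρ (i, 1)).1 then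
      hyperbolicSign (ρ (i, 0)).2 (ρ (i, 1)).2 else 0) := by
  by_cases h : ∀ i, (ρ (i, 0)).1 = (ρ (i, 1)).1
  swap
  · push Not at h
    obtain ⟨i, hi⟩ := h
    rw [Finset.prod_eq_zero (Finset.mem_univ i) (if_neg hi), mul_zero]
  have hfst : ∀ i b, (ρ (i, b)).1 = (ρ (i, 0)).1 := fun i b => by
    fin_cases b
    · rfl
    · exact (h i).symm
  have hs : ∀ i, Function.Injective fun b => (ρ (i, b)).2 := fun i b c hbc =>
    (Prod.mk.inj (ρ.injective (Prod.ext ((hfst i b).trans (hfst i c).symm) hbc))).2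
  let s : Fin m → Perm (Fin 2) := fun i => .ofBijective _ (Finite.injective_iff_bijective.1 (hs i))
  have hp : Function.Injective fun i => (ρ (i, 0)).1 := fun i j hij => by
    obtain ⟨b, hb⟩ := (s i).surjective (ρ (j, 0)).2
    exact (Prod.mk.inj (ρ.injective (Prod.ext ((hfst i b).trans hij) hb))).1
  let p : Perm (Fin m) := .ofBijective _ (Finite.injective_iff_bijective.1 hp)
  have hρ : ρ = prodCongrLeft (fun _ => p) * prodCongrRight s := by
    ext x : 1
    exact Prod.ext (hfst x.1 x.2) rfl
  have hsign : Perm.sign ρ = ∏ i, Perm.sign (s i) := by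
    rw [hρ, Perm.sign_mul, Perm.sign_prodCongrLeft, Perm.sign_prodCongrRight]
    simp
  have hprod : ∏ i, (if (ρ (i, 0)).1 = (ρ (i, 1)).1 then
      hyperbolicSign (ρ (i, 0)).2 (ρ (i, 1)).2 else 0) = ((Perm.sign ρ : ℤ) : ℝ) := by
    rw [hsign]
    push_cast
    refine Finset.prod_congr rfl fun i _ => ?_
    rw [if_pos (h i)]
    exact hyperbolicSign_perm (s i)
  rw [hprod]
  exact mul_self_nonneg _

/-- The enumeration of `2 m + 1` vectors as one distinguished vector at position `0`, followed by
`m` pairs at the positions `2 i + 1` and `2 i + 2`. -/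
def pairIndex (m : ℕ) : Option (Fin m × Fin 2) ≃ Fin (2 * m + 1) :=
  (optionCongr (finProdFinEquiv.trans (finCongr (mul_comm m 2)))).trans (finSuccEquiv (2 * m)).symm

theorem pairIndex_none (m : ℕ) : pairIndex m none = 0 := rfl

theorem pairIndex_some_zero {m : ℕ} (i : Fin m) :
    pairIndex m (some (i, 0)) = ⟨2 * i.val + 1, by omega⟩ := by
  ext; simp [pairIndex, finProdFinEquiv]

theorem pairIndex_some_one {m : ℕ} (i : Fin m) :
    pairIndex m (some (i, 1)) = ⟨2 * i.val + 2, by omega⟩ := by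
  ext; simp [pairIndex, finProdFinEquiv]; omega

variable {V : Type*} [AddCommGroup V] [Module ℝ V] [TopologicalSpace V]

theorem ContinuousAlternatingMap.map_vec_two_swap (β : V [⋀^Fin 2]→L[ℝ] ℝ) (u v : V) :
    β ![u, v] = -β ![v, u] := by
  have h : ![v, u] ∘ Equiv.swap (0 : Fin 2) 1 = ![u, v] := by
    ext k; fin_cases k <;> rfl
  rw [← h]
  exact β.toAlternatingMap.map_swap ![v, u] (by decide)

/-- An alternating two-form as a bilinear map. -/
def ContinuousAlternatingMap.toBilin (β : V [⋀^Fin 2]→L[ℝ] ℝ) : V →ₗ[ℝ] V →ₗ[ℝ] ℝ :=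
  LinearMap.mk₂ ℝ (fun u v => β ![u, v])
    (fun u u' v => by simpa using β.toAlternatingMap.map_vecCons_add ![v] u u')
    (fun c u v => by simpa using β.toAlternatingMap.map_vecCons_smul ![v] c u)
    (fun u v v' => by
      simp only [β.map_vec_two_swap u]
      rw [← neg_add]
      exact congrArg Neg.neg (β.toAlternatingMap.map_vecCons_add ![u] v v'))
    (fun c u v => by
      simp only [β.map_vec_two_swap u]
      simpa using β.toAlternatingMap.map_vecCons_smul ![u] c v)

@[simp]
theorem ContinuousAlternatingMap.toBilin_apply (β : V [⋀^Fin 2]→L[ℝ] ℝ) (u v : V) :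
    β.toBilin u v = β ![u, v] := rfl

theorem ContinuousAlternatingMap.isAlt_toBilin (β : V [⋀^Fin 2]→L[ℝ] ℝ) : β.toBilin.IsAlt :=
  fun u => β.map_eq_zero_of_eq ![u, u] (i := 0) (j := 1) rfl (by decide)

theorem wedgePow_comp_pairIndex_symm (α : V →L[ℝ] ℝ) (β : V [⋀^Fin 2]→L[ℝ] ℝ) {m : ℕ}
    (w : Option (Fin m × Fin 2) → V) :
    wedgePow α β m (w ∘ (pairIndex m).symm) =
      ∑ τ : Perm (Option (Fin m × Fin 2)), ((Perm.sign τ : ℤ) : ℝ) *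
        (α (w (τ none)) * ∏ i, β ![w (τ (some (i, 0))), w (τ (some (i, 1)))]) := by
  rw [wedgePow, ← (pairIndex m).permCongr.sum_comp]
  refine Finset.sum_congr rfl fun τ _ => ?_
  simp only [← pairIndex_none, ← pairIndex_some_zero, ← pairIndex_some_one, Perm.sign_permCongr,
    Function.comp_apply, permCongr_apply, symm_apply_apply]

/-- On a symplectic basis `e, f` of `ker α` for `β`, completed by a vector `r` with `α r = 1`, the
form `α ∧ β ∧ ⋯ ∧ β` does not vanish: all the terms of the defining sum are nonnegative and the
term of the identity is `1`. -/
theorem exists_wedgePow_ne_zero (α : V →L[ℝ] ℝ) (β : V [⋀^Fin 2]→L[ℝ] ℝ) {m : ℕ} (r : V)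
    (e f : Fin m → V) (hr : α r = 1) (he : ∀ i, α (e i) = 0) (hf : ∀ i, α (f i) = 0)
    (hee : ∀ i j, β ![e i, e j] = 0) (hff : ∀ i j, β ![f i, f j] = 0)
    (hef : ∀ i j, β ![e i, f j] = if i = j then 1 else 0) :
    ∃ v : Fin (2 * m + 1) → V, wedgePow α β m v ≠ 0 := by
  have hfe : ∀ i j, β ![f i, e j] = if i = j then -1 else 0 := fun i j => by
    rw [β.map_vec_two_swap, hef]
    split_ifs <;> simp_all
  let w : Option (Fin m × Fin 2) → V := fun o => o.elim r fun x => if x.2 = 0 then e x.1 else f x.1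
  have hα : ∀ x, α (w (some x)) = 0 := fun x => by
    change α (if x.2 = 0 then e x.1 else f x.1) = 0
    split_ifs
    · exact he _
    · exact hf _
  have hβ : ∀ x y : Fin m × Fin 2, β ![w (some x), w (some y)] =
      if x.1 = y.1 then hyperbolicSign x.2 y.2 else 0 := by
    rintro ⟨i, b⟩ ⟨j, c⟩
    fin_cases b <;> fin_cases c <;> simp [w, hee, hff, hef, hfe, hyperbolicSign]
  refine ⟨w ∘ (pairIndex m).symm, ne_of_gt ?_⟩
  rw [wedgePow_comp_pairIndex_symm]
  refine Finset.sum_pos' (fun τ _ => ?_) ⟨1, Finset.mem_univ _, ?_⟩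
  · rcases hτ : τ none with _ | x
    · obtain ⟨ρ, rfl⟩ : ∃ ρ, τ = optionCongr ρ := by
        refine ⟨removeNone τ, Equiv.ext fun o => ?_⟩
        rcases o with _ | x
        · simpa using hτ
        · refine (removeNone_some τ (Option.ne_none_iff_exists'.1 fun hx => ?_)).symm
          exact Option.some_ne_none x (τ.injective (hx.trans hτ.symm))
      simp only [optionCongr_apply, Option.map_some, hβ, optionCongr_sign]
      rw [show α (w none) = 1 from hr, one_mul]
      exact sign_mul_prod_hyperbolicSign_nonneg ρ
    · rw [hα]
      simp
  · simp only [Perm.coe_one, id, hβ]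
    rw [show α (w none) = 1 from hr]
    simp [hyperbolicSign]

end WedgePow

/-! ### Contact linear algebra of a transverse hyperplane -/

section Hyperplane

variable {V : Type*} [AddCommGroup V] [Module ℝ V] [TopologicalSpace V] [FiniteDimensional ℝ V]
  {T : Type*} [AddCommGroup T] [Module ℝ T] [TopologicalSpace T]

/-- Linear form of the fact that a hypersurface transverse to the Liouville field is of contact
type. Here `V` is symplectic with form `-σ`, the hyperplane `ker l` is the injective image of `D`
and `X` is transverse to it; the vector `r` with `ι_r ω = l` spans the kernel of `σ` on the
hyperplane, and the symplectic complement of the plane spanned by `X` and `r` is the kernel of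
`ι_X ω` in the hyperplane. -/
theorem exists_wedgePow_pullback_ne_zero (σ : V [⋀^Fin 2]→L[ℝ] ℝ)
    (hσ : ∀ u, (∀ v, σ ![u, v] = 0) → u = 0) (α : V →L[ℝ] ℝ) (X : V)
    (hX : ∀ v, α v = -σ ![X, v]) (l : V →ₗ[ℝ] ℝ) (hl : l ≠ 0) (D : T →L[ℝ] V)
    (hD : Function.Injective D) (hlD : ∀ t, l (D t) = 0)
    (htop : Submodule.span ℝ {X} ⊔ LinearMap.range D.toLinearMap = ⊤) :
    ∃ m : ℕ, finrank ℝ T = 2 * m + 1 ∧ ∃ v : Fin (2 * m + 1) → T,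
      wedgePow (α.comp D) (σ.compContinuousLinearMap D) m v ≠ 0 := by
  have hB := σ.isAlt_toBilin
  have hnd : ∀ u, (∀ v, σ.toBilin u v = 0) → u = 0 := hσ
  have hX' : ∀ v, α v = σ.toBilin v X := fun v => by
    rw [hX, ← hB.neg]
    rfl
  have hdecomp : ∀ v, ∃ (a : ℝ) (t : T), v = a • X + D t := fun v => by
    obtain ⟨y, hy, z, ⟨t, rfl⟩, rfl⟩ := Submodule.mem_sup.1 (htop ▸ Submodule.mem_top (x := v))
    obtain ⟨a, rfl⟩ := Submodule.mem_span_singleton.1 hy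
    exact ⟨a, t, rfl⟩
  have hlX : l X ≠ 0 := fun h0 => hl <| LinearMap.ext fun v => by
    obtain ⟨a, t, rfl⟩ := hdecomp v
    simp [h0, hlD]
  have hker : ∀ v, l v = 0 → ∃ t, D t = v := fun v hv => by
    obtain ⟨a, t, rfl⟩ := hdecomp v
    have ha : a = 0 := by simpa [hlD, hlX] using hv
    exact ⟨t, by simp [ha]⟩
  -- The multiple of the Hamiltonian vector of `l` normalised by `α r = 1`.
  obtain ⟨r, hr⟩ : ∃ r, σ.toBilin r = (l X)⁻¹ • l := by
    have hinj : Function.Injective σ.toBilin := (injective_iff_map_eq_zero _).2 fun u hu =>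
      hnd u fun v => by rw [hu]; rfl
    exact (LinearMap.injective_iff_surjective_of_finrank_eq_finrank
      Subspace.dual_finrank_eq.symm).1 hinj _
  have hαr : α r = 1 := by
    rw [hX', hr]
    simp [hlX]
  have hXr : σ.toBilin X r ≠ 0 := by
    rw [← hB.neg, ← hX', hαr]
    simp
  have hlr : l r = 0 := by
    have := hB.self_eq_zero r
    rw [hr] at this
    simpa [hlX] using this
  have hlW : ∀ w, σ.toBilin r w = 0 → l w = 0 := fun w hw => by
    rw [hr] at hw
    simpa [hlX] using hw
  have hdim := hB.finrank_ker_inf_ker_add_two hXr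
  set W := LinearMap.ker (σ.toBilin X) ⊓ LinearMap.ker (σ.toBilin r)
  obtain ⟨m, e, f, hm, hee, hff, hef⟩ :=
    LinearMap.IsAlt.exists_symplectic_basis (B := σ.toBilin.domRestrict₁₂ W W) (fun w => hB w)
      (fun w hw => Subtype.ext <| hB.eq_zero_of_mem_ker_inf_ker hnd hXr w.2
        fun w' hw' => hw ⟨w', hw'⟩)
  have hαW : ∀ w : W, α w = 0 := fun w => by
    rw [hX', ← hB.neg, w.2.1, neg_zero]
  choose r' hr' using hker r hlr
  choose e' he' using fun i => hker (e i) (hlW _ (e i).2.2)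
  choose f' hf' using fun i => hker (f i) (hlW _ (f i).2.2)
  have hβ : ∀ s t, σ.compContinuousLinearMap D ![s, t] = σ.toBilin (D s) (D t) := fun s t => by
    rw [ContinuousAlternatingMap.compContinuousLinearMap_apply,
      ContinuousAlternatingMap.toBilin_apply]
    congr 1
    ext k; fin_cases k <;> rfl
  refine ⟨m, ?_, exists_wedgePow_ne_zero _ _ r' e' f' (by simp [hr', hαr])
    (fun i => by simp [he', hαW]) (fun i => by simp [hf', hαW]) (fun i j => ?_) (fun i j => ?_)
    fun i j => ?_⟩
  · have hrange : LinearMap.range D.toLinearMap = LinearMap.ker l := by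
      ext v
      refine ⟨?_, fun hv => hker v hv⟩
      rintro ⟨t, rfl⟩
      exact hlD t
    have h1 := LinearMap.finrank_range_of_inj (f := D.toLinearMap) hD
    have h2 := Module.Dual.finrank_ker_add_one_of_ne_zero hl
    rw [hrange] at h1
    omega
  · rw [hβ, he', he']
    exact hee i j
  · rw [hβ, hf', hf']
    exact hff i j
  · rw [hβ, he', hf']
    exact hef i j

end Hyperplane

/-! ### Pullback and exterior derivative of one-forms -/

section Pullback

variable {E : Type*} [NormedAddCommGroup E] [NormedSpace ℝ E]
  {M : Type*} [TopologicalSpace M] [ChartedSpace E M] [IsManifold 𝓘(ℝ, E) ∞ M]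
  {E' : Type*} [NormedAddCommGroup E'] [NormedSpace ℝ E']
  {N : Type*} [TopologicalSpace N] [ChartedSpace E' N] [IsManifold 𝓘(ℝ, E') ∞ N]

/-- A one-form near `x₀`, read in the trivialisation of the tangent bundle at `x₀`. -/
noncomputable def OneForm.inTrivialization (θ : OneForm E M) (x₀ x : M) : E →L[ℝ] ℝ :=
  (θ x).comp ((trivializationAt E (TangentSpace 𝓘(ℝ, E)) x₀).symmL ℝ x)

theorem OneForm.isSmooth_iff (θ : OneForm E M) :
    θ.IsSmooth ↔ ∀ x₀, ContMDiffAt 𝓘(ℝ, E) 𝓘(ℝ, E →L[ℝ] ℝ) ∞ (θ.inTrivialization x₀) x₀ := by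
  refine forall_congr' fun x₀ => ?_
  rw [contMDiffAt_hom_bundle]
  simp only [TotalSpace.mk']
  refine (and_iff_right contMDiffAt_id).trans ?_
  have h : (fun x => ContinuousLinearMap.inCoordinates E (TangentSpace 𝓘(ℝ, E)) ℝ
      (Bundle.Trivial M ℝ) x₀ x x₀ x (θ x)) = θ.inTrivialization x₀ := by
    ext x v
    simp only [ContinuousLinearMap.inCoordinates]
    change (Trivialization.continuousLinearMapAt ℝ (Bundle.Trivial.trivialization M ℝ) x) _ = _
    rw [Bundle.Trivial.continuousLinearMapAt_trivialization]
    rfl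
  rw [h]

/-- In trivialisations, `f^* θ` is the composition of `θ` along `f` with the derivative of `f` in
tangent coordinates; both depend smoothly on the point. -/
theorem OneForm.IsSmooth.pullback {θ : OneForm E M} (hθ : θ.IsSmooth) {f : N → M}
    (hf : ContMDiff 𝓘(ℝ, E') 𝓘(ℝ, E) ∞ f) : (OneForm.pullback (E' := E') f θ).IsSmooth := by
  rw [OneForm.isSmooth_iff] at hθ ⊢
  intro x₀
  have h1 := (hθ (f x₀)).comp x₀ (hf x₀)
  have h2 := (hf x₀).mfderiv_const (m := ∞) (by simp)
  refine (h1.clm_comp h2).congr_of_eventuallyEq ?_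
  have hnhds : f ⁻¹' (chartAt E (f x₀)).source ∈ 𝓝 x₀ :=
    hf.continuous.continuousAt.preimage_mem_nhds (chart_source_mem_nhds E (f x₀))
  filter_upwards [hnhds] with x hx
  ext v
  simp only [OneForm.inTrivialization, OneForm.pullback, inTangentCoordinates,
    ContinuousLinearMap.inCoordinates, ContinuousLinearMap.comp_apply, Function.comp_apply, id]
  rw [Trivialization.symmL_continuousLinearMapAt]
  simpa using hx

theorem OneForm.inChart_eventuallyEq (θ : OneForm E M) (x : M) :
    θ.inChart x =ᶠ[𝓝 (chartAt E x x)] fun y => ContinuousAlternatingMap.ofSubsingleton ℝ E ℝ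
      (0 : Fin 1) (θ.inTrivialization x ((chartAt E x).symm y)) := by
  filter_upwards [(chartAt E x).open_target.mem_nhds (mem_chart_target E x)] with y hy
  rw [OneForm.inChart, OneForm.inTrivialization,
    TangentBundle.symmL_trivializationAt ((chartAt E x).map_target hy)]
  simp only [mfld_simps, mfderivWithin_univ]
  rw [(chartAt E x).right_inv hy]

theorem OneForm.IsSmooth.differentiableAt_inChart {θ : OneForm E M} (hθ : θ.IsSmooth) (x : M) :
    DifferentiableAt ℝ (θ.inChart x) (chartAt E x x) := by
  refine DifferentiableAt.congr_of_eventuallyEq ?_ (θ.inChart_eventuallyEq x)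
  have h1 := θ.isSmooth_iff.1 hθ x
  have h2 : ContMDiffAt 𝓘(ℝ, E) 𝓘(ℝ, E) ∞ (chartAt E x).symm (chartAt E x x) :=
    (contMDiffOn_chart_symm (x := x)).contMDiffAt
      ((chartAt E x).open_target.mem_nhds (mem_chart_target E x))
  have h3 := h1.comp_of_eq h2 ((chartAt E x).left_inv (mem_chart_source E x))
  exact (ContinuousAlternatingMap.ofSubsingletonLIE (𝕜 := ℝ) (E := E) (F := ℝ)
    (0 : Fin 1)).differentiable.differentiableAt.comp _ (h3.contDiffAt.differentiableAt (by simp))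

/-- The exterior derivative is natural: `d (f^* θ) = f^* (dθ)`. -/
theorem OneForm.IsSmooth.extD_pullback {θ : OneForm E M} (hθ : θ.IsSmooth) {f : N → M}
    (hf : ContMDiff 𝓘(ℝ, E') 𝓘(ℝ, E) ∞ f) (x : N) :
    (OneForm.pullback (E' := E') f θ).extD x =
      (θ.extD (f x)).compContinuousLinearMap (mfderiv 𝓘(ℝ, E') 𝓘(ℝ, E) f x) := by
  set φ := chartAt E' x with hφ
  set ψ := chartAt E (f x) with hψ
  have hxφ : x ∈ φ.source := mem_chart_source E' x
  have hfx : f x ∈ ψ.source := mem_chart_source E (f x)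
  have hdφ : φ.MDifferentiable 𝓘(ℝ, E') 𝓘(ℝ, E') := mdifferentiable_chart x
  have hdψ : ψ.MDifferentiable 𝓘(ℝ, E) 𝓘(ℝ, E) := mdifferentiable_chart (f x)
  have hsrc : IsOpen (φ.source ∩ f ⁻¹' ψ.source) :=
    φ.open_source.inter (ψ.open_source.preimage hf.continuous)
  let F : E' → E := ψ ∘ f ∘ φ.symm
  have hFx : F (φ x) = ψ (f x) := by simp [F, φ.left_inv hxφ]
  have hFc : ∀ z ∈ φ.source ∩ f ⁻¹' ψ.source, ContDiffAt ℝ ∞ F (φ z) := fun z hz => by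
    have h1 : ContMDiffAt 𝓘(ℝ, E') 𝓘(ℝ, E') ∞ φ.symm (φ z) :=
      (contMDiffOn_chart_symm (x := x)).contMDiffAt (φ.open_target.mem_nhds (φ.map_source hz.1))
    have h2 : ContMDiffAt 𝓘(ℝ, E) 𝓘(ℝ, E) ∞ ψ (f z) :=
      (contMDiffOn_chart (x := f x)).contMDiffAt (ψ.open_source.mem_nhds hz.2)
    have h3 := hf.contMDiffAt.comp_of_eq h1 (φ.left_inv hz.1)
    exact (h2.comp_of_eq h3 (by simp [φ.left_inv hz.1])).contDiffAt
  -- `F` intertwines the charts, so its derivative is that of `f` read in them.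
  have hFd : ∀ z ∈ φ.source ∩ f ⁻¹' ψ.source, ∀ v : TangentSpace 𝓘(ℝ, E') z,
      fderiv ℝ F (φ z) (mfderiv 𝓘(ℝ, E') 𝓘(ℝ, E') φ z v) =
        mfderiv 𝓘(ℝ, E) 𝓘(ℝ, E) ψ (f z) (mfderiv 𝓘(ℝ, E') 𝓘(ℝ, E) f z v) := fun z hz v => by
    have heq : F ∘ φ =ᶠ[𝓝 z] ψ ∘ f := by
      filter_upwards [φ.open_source.mem_nhds hz.1] with z' hz'
      simp [F, φ.left_inv hz']
    have hFm : MDifferentiableAt 𝓘(ℝ, E') 𝓘(ℝ, E) F (φ z) :=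
      ((hFc z hz).differentiableAt (by simp)).mdifferentiableAt
    have h1 := mfderiv_comp_apply z hFm (hdφ.mdifferentiableAt hz.1) v
    have h2 := mfderiv_comp_apply z (hdψ.mdifferentiableAt hz.2)
      (hf.contMDiffAt.mdifferentiableAt (by simp)) v
    rw [heq.mfderiv_eq, mfderiv_eq_fderiv] at h1
    exact h1.symm.trans h2
  -- Tangent spaces at equal points are both the model space; `θ` respects this identification.
  have hθ_congr : ∀ a b : M, a = b → (θ a : E →L[ℝ] ℝ) = θ b := by
    rintro a _ rfl
    rfl
  -- In the charts at `x` and `f x` the pullback of forms is the pullback along `F`.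
  have hchart : (OneForm.pullback (E' := E') f θ).inChart x =ᶠ[𝓝 (φ x)]
      fun y => (θ.inChart (f x) (F y)).compContinuousLinearMap (fderiv ℝ F y) := by
    have hnhds : φ.target ∩ φ.symm ⁻¹' (φ.source ∩ f ⁻¹' ψ.source) ∈ 𝓝 (φ x) :=
      (φ.symm.isOpen_inter_preimage hsrc).mem_nhds
        ⟨φ.map_source hxφ, by simpa [φ.left_inv hxφ] using ⟨hxφ, hfx⟩⟩
    filter_upwards [hnhds] with y hy
    obtain ⟨hy, hz⟩ := hy
    ext v
    have h1 := hFd _ hz (mfderiv 𝓘(ℝ, E') 𝓘(ℝ, E') φ.symm y (v 0))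
    have h2 := DFunLike.congr_fun (hdφ.comp_symm_deriv hy) (v 0)
    have h3 := DFunLike.congr_fun (hdψ.symm_comp_deriv hz.2)
      (mfderiv 𝓘(ℝ, E') 𝓘(ℝ, E) f (φ.symm y) (mfderiv 𝓘(ℝ, E') 𝓘(ℝ, E') φ.symm y (v 0)))
    have h4 := hθ_congr (ψ.symm (F y)) (f (φ.symm y)) (ψ.left_inv hz.2)
    have h5 : fderiv ℝ F y (v 0) = mfderiv 𝓘(ℝ, E) 𝓘(ℝ, E) ψ (f (φ.symm y))
        (mfderiv 𝓘(ℝ, E') 𝓘(ℝ, E) f (φ.symm y)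
          (mfderiv 𝓘(ℝ, E') 𝓘(ℝ, E') φ.symm y (v 0))) := by
      rw [← h1, φ.right_inv hy]
      exact congrArg _ h2.symm
    change θ (f (φ.symm y)) _ = θ (ψ.symm (F y)) (mfderiv 𝓘(ℝ, E) 𝓘(ℝ, E) ψ.symm (F y)
      (fderiv ℝ F y (v 0)))
    rw [h5]
    exact ((DFunLike.congr_fun h4 _).trans (congrArg (θ (f (φ.symm y))) h3)).symm
  have hmain : extDeriv ((OneForm.pullback (E' := E') f θ).inChart x) (φ x) =
      (extDeriv (θ.inChart (f x)) (ψ (f x))).compContinuousLinearMap (fderiv ℝ F (φ x)) := by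
    have hd : DifferentiableAt ℝ (θ.inChart (f x)) (F (φ x)) := by
      rw [hFx]
      exact hθ.differentiableAt_inChart (f x)
    rw [hchart.extDeriv_eq, extDeriv_pullback hd (hFc x ⟨hxφ, hfx⟩)
      (by simpa using ENat.LEInfty.out), hFx]
  ext v
  rw [OneForm.extD, ← hφ, hmain]
  change extDeriv (θ.inChart (f x)) (ψ (f x)) _ = extDeriv (θ.inChart (f x)) (ψ (f x)) _
  congr 1
  ext k
  exact hFd x ⟨hxφ, hfx⟩ (v k)

end Pullback

/-! ### Immersions -/

/-- The local normal form defining immersions gives an injective derivative. -/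
theorem Manifold.IsImmersionAt.injective_mfderiv
    {E : Type*} [NormedAddCommGroup E] [NormedSpace ℝ E]
    {M : Type*} [TopologicalSpace M] [ChartedSpace E M] [IsManifold 𝓘(ℝ, E) ∞ M]
    {E' : Type*} [NormedAddCommGroup E'] [NormedSpace ℝ E']
    {N : Type*} [TopologicalSpace N] [ChartedSpace E' N] [IsManifold 𝓘(ℝ, E') ∞ N]
    {f : N → M} {x : N} (hf : Manifold.IsImmersionAt 𝓘(ℝ, E') 𝓘(ℝ, E) ∞ f x) :
    Function.Injective (mfderiv 𝓘(ℝ, E') 𝓘(ℝ, E) f x) := by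
  have hab : ∀ z ∈ hf.domChart.source, hf.codChart (f z) = hf.equiv (hf.domChart z, 0) := by
    intro z hz
    have h0 := (hf.domChart.extend 𝓘(ℝ, E')).map_source (x := z)
      (by rwa [OpenPartialHomeomorph.extend_source])
    have h1 := hf.writtenInCharts h0
    simpa [mfld_simps, hf.domChart.left_inv hz] using h1
  let a := hf.domChart
  let b := hf.codChart
  have ha : a ∈ IsManifold.maximalAtlas 𝓘(ℝ, E') 1 N :=
    IsManifold.maximalAtlas_subset_of_le (by simp) hf.domChart_mem_maximalAtlas
  have hb : b ∈ IsManifold.maximalAtlas 𝓘(ℝ, E) 1 M :=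
    IsManifold.maximalAtlas_subset_of_le (by simp) hf.codChart_mem_maximalAtlas
  have hda : a.MDifferentiable 𝓘(ℝ, E') 𝓘(ℝ, E') :=
    ⟨fun z hz => (mdifferentiableAt_of_mem_maximalAtlas ha hz).mdifferentiableWithinAt,
      fun z hz => (mdifferentiableAt_symm_of_mem_maximalAtlas ha hz).mdifferentiableWithinAt⟩
  have hdb := mdifferentiableAt_of_mem_maximalAtlas hb hf.mem_codChart_source
  let p : E →L[ℝ] E' := (ContinuousLinearMap.fst ℝ E' hf.complement).comp
    (hf.equiv.symm : E →L[ℝ] E' × hf.complement)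
  -- In adapted charts `f` is a linear inclusion, so a linear projection recovers the chart of `N`.
  have heq : p ∘ b ∘ f =ᶠ[𝓝 x] a := by
    filter_upwards [a.open_source.mem_nhds hf.mem_domChart_source] with z hz
    have h1 : b (f z) = hf.equiv (a z, 0) := hab z hz
    simp [p, h1]
  refine (injective_iff_map_eq_zero _).2 fun v hv => ?_
  have hfd := hf.contMDiffAt.mdifferentiableAt (by simp)
  have h1 : MDifferentiableAt 𝓘(ℝ, E') 𝓘(ℝ, E) (b ∘ f) x := hdb.comp x hfd
  have hp : MDifferentiableAt 𝓘(ℝ, E) 𝓘(ℝ, E') p (b (f x)) :=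
    p.differentiableAt.mdifferentiableAt
  have h2 := mfderiv_comp_apply x hp h1 v
  rw [mfderiv_comp_apply x hdb hfd, hv, map_zero, map_zero, heq.mfderiv_eq] at h2
  exact (injective_iff_map_eq_zero _).1 (hda.mfderiv_injective hf.mem_domChart_source) v h2

/-! ### Lie group actions and fundamental vector fields -/

/-- The pullback of an invariant one-form along an equivariant map is invariant. -/
theorem IsInvariantForm.pullback
    (F : Type*) [NormedAddCommGroup F] [NormedSpace ℝ F]
    {G : Type*} [TopologicalSpace G] [ChartedSpace F G] [Group G]
    {E : Type*} [NormedAddCommGroup E] [NormedSpace ℝ E]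
    {M : Type*} [TopologicalSpace M] [ChartedSpace E M] [MulAction G M]
    {E' : Type*} [NormedAddCommGroup E'] [NormedSpace ℝ E']
    {N : Type*} [TopologicalSpace N] [ChartedSpace E' N] [MulAction G N]
    [ContMDiffSMul 𝓘(ℝ, F) 𝓘(ℝ, E') ∞ G N]
    [ContMDiffSMul 𝓘(ℝ, F) 𝓘(ℝ, E) ∞ G M] {θ : OneForm E M} (hθ : IsInvariantForm G θ) {f : N → M}
    (hf : MDifferentiable 𝓘(ℝ, E') 𝓘(ℝ, E) f) (hfG : ∀ (g : G) (x : N), f (g • x) = g • f x) :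
    IsInvariantForm G (OneForm.pullback (E' := E') f θ) := by
  intro g
  funext x
  have hN : ContMDiff 𝓘(ℝ, E') 𝓘(ℝ, E') ∞ (fun y : N => g • y) :=
    (ContMDiffSMul.contMDiff_smul (I := 𝓘(ℝ, F)) (I' := 𝓘(ℝ, E'))).comp
      (contMDiff_const.prodMk contMDiff_id)
  have hM : ContMDiff 𝓘(ℝ, E) 𝓘(ℝ, E) ∞ (fun y : M => g • y) :=
    (ContMDiffSMul.contMDiff_smul (I := 𝓘(ℝ, F)) (I' := 𝓘(ℝ, E))).comp
      (contMDiff_const.prodMk contMDiff_id)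
  ext v
  have h1 := mfderiv_comp_apply x (hf (g • x)) (hN.contMDiffAt.mdifferentiableAt (by simp)) v
  have h2 := mfderiv_comp_apply x (hM.contMDiffAt.mdifferentiableAt (by simp)) (hf x) v
  -- Both sides are `θ` evaluated on the derivative of `f ∘ g = g ∘ f`.
  have hfun : (f ∘ fun y : N => g • y) = (fun y : M => g • y) ∘ f := funext fun y => hfG g y
  rw [hfun] at h1
  have hcongr : ∀ y z : M, y = z → (θ y : E →L[ℝ] ℝ) = θ z := by
    rintro y _ rfl
    rfl
  have h3 := DFunLike.congr_fun (congrFun (hθ g) (f x)) (mfderiv 𝓘(ℝ, E') 𝓘(ℝ, E) f x v)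
  exact (congrArg (θ (f (g • x))) (h1.symm.trans h2)).trans
    ((DFunLike.congr_fun (hcongr (f (g • x)) (g • f x) (hfG g x)) _).trans h3)

section Action

variable {F : Type*} [NormedAddCommGroup F] [NormedSpace ℝ F] [CompleteSpace F]
  {G : Type*} [TopologicalSpace G] [T2Space G] [ChartedSpace F G] [Group G]
  [LieGroup 𝓘(ℝ, F) ∞ G]

theorem oneParameterSubgroup_zero (ξ : GroupLieAlgebra 𝓘(ℝ, F) G) :
    oneParameterSubgroup ξ 0 = 1 :=
  (exists_oneParameterSubgroup ξ).choose_spec.1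

theorem isMIntegralCurve_oneParameterSubgroup (ξ : GroupLieAlgebra 𝓘(ℝ, F) G) :
    IsMIntegralCurve (oneParameterSubgroup ξ) (mulInvariantVectorField ξ) :=
  (exists_oneParameterSubgroup ξ).choose_spec.2

/-- The curve `s ↦ γ_ξ (s t)` is an integral curve for `t ξ`, so it is `γ_{t ξ}` by uniqueness. -/
theorem lieExp_smul (t : ℝ) (ξ : GroupLieAlgebra 𝓘(ℝ, F) G) :
    lieExp (t • ξ) = oneParameterSubgroup ξ t := by
  have : LieGroup 𝓘(ℝ, F) (minSmoothness ℝ 3) G :=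
    LieGroup.of_le (n := ∞) (by simpa using ENat.LEInfty.out)
  have hv : ContMDiff 𝓘(ℝ, F) 𝓘(ℝ, F).tangent 1 (fun g : G =>
      (⟨g, mulInvariantVectorField (t • ξ) g⟩ : TangentBundle 𝓘(ℝ, F) G)) :=
    (contMDiff_mulInvariantVectorField (t • ξ)).of_le (by simp)
  have h1 := (isMIntegralCurve_oneParameterSubgroup ξ).comp_mul t
  have h2 : t • (mulInvariantVectorField ξ : ∀ g : G, TangentSpace 𝓘(ℝ, F) g) =
      mulInvariantVectorField (t • ξ) := by
    ext g
    exact (map_smul (mfderiv 𝓘(ℝ, F) 𝓘(ℝ, F) (fun x : G => g * x) 1) t ξ).symm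
  rw [h2] at h1
  have h3 := isMIntegralCurve_Ioo_eq_of_contMDiff_boundaryless (t₀ := 0) hv
    (isMIntegralCurve_oneParameterSubgroup (t • ξ)) h1 (by simp [oneParameterSubgroup_zero])
  rw [lieExp, h3]
  simp

theorem mdifferentiableAt_lieExp_smul (ξ : GroupLieAlgebra 𝓘(ℝ, F) G) (t : ℝ) :
    MDifferentiableAt 𝓘(ℝ, ℝ) 𝓘(ℝ, F) (fun s : ℝ => lieExp (s • ξ)) t := by
  simp only [lieExp_smul]
  exact (isMIntegralCurve_oneParameterSubgroup ξ t).mdifferentiableAt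

variable {E : Type*} [NormedAddCommGroup E] [NormedSpace ℝ E]
  {M : Type*} [TopologicalSpace M] [ChartedSpace E M] [MulAction G M]
  {E' : Type*} [NormedAddCommGroup E'] [NormedSpace ℝ E']
  {N : Type*} [TopologicalSpace N] [ChartedSpace E' N] [MulAction G N]

/-- Fundamental vector fields are related by equivariant maps. -/
theorem mfderiv_fundamentalField [ContMDiffSMul 𝓘(ℝ, F) 𝓘(ℝ, E') ∞ G N] {f : N → M}
    (hf : MDifferentiable 𝓘(ℝ, E') 𝓘(ℝ, E) f) (hfG : ∀ (g : G) (x : N), f (g • x) = g • f x)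
    (ξ : GroupLieAlgebra 𝓘(ℝ, F) G) (x : N) :
    mfderiv 𝓘(ℝ, E') 𝓘(ℝ, E) f x (fundamentalField ξ x) = fundamentalField ξ (f x) := by
  have horbit : MDifferentiableAt 𝓘(ℝ, ℝ) 𝓘(ℝ, E') (fun t : ℝ => lieExp (t • ξ) • x) 0 := by
    have h1 : ContMDiff 𝓘(ℝ, F) 𝓘(ℝ, E') ∞ (fun g : G => g • x) :=
      (ContMDiffSMul.contMDiff_smul (I := 𝓘(ℝ, F)) (I' := 𝓘(ℝ, E'))).comp
        (contMDiff_id.prodMk contMDiff_const)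
    exact (h1.contMDiffAt.mdifferentiableAt (by simp)).comp 0 (mdifferentiableAt_lieExp_smul ξ 0)
  have hcomp := mfderiv_comp_apply (0 : ℝ) (hf _) horbit (1 : ℝ)
  -- The chain rule gives the derivative of `f` at `exp (0 ξ) • x`, propositionally equal to `x`.
  have hcongr : ∀ y z : N, y = z → (mfderiv 𝓘(ℝ, E') 𝓘(ℝ, E) f y : E' →L[ℝ] E) =
      mfderiv 𝓘(ℝ, E') 𝓘(ℝ, E) f z := by
    rintro y _ rfl
    rfl
  have hx : lieExp ((0 : ℝ) • ξ) • x = x := by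
    rw [lieExp_smul, oneParameterSubgroup_zero, one_smul]
  have hfun : (f ∘ fun t : ℝ => lieExp (t • ξ) • x) = fun t : ℝ => lieExp (t • ξ) • f x :=
    funext fun t => hfG _ _
  rw [hfun] at hcomp
  exact (hcomp.trans (DFunLike.congr_fun (hcongr (lieExp ((0 : ℝ) • ξ) • x) x hx) _)).symm

/-- The pullback of a momentum map along an equivariant map is a momentum map. -/
theorem IsMomentumMap.pullback [ContMDiffSMul 𝓘(ℝ, F) 𝓘(ℝ, E') ∞ G N] {θ : OneForm E M}
    {J : M → Module.Dual ℝ (GroupLieAlgebra 𝓘(ℝ, F) G)} (hJ : IsMomentumMap θ J) {f : N → M}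
    (hf : ContMDiff 𝓘(ℝ, E') 𝓘(ℝ, E) ∞ f) (hfG : ∀ (g : G) (x : N), f (g • x) = g • f x) :
    IsMomentumMap (OneForm.pullback (E' := E') f θ) (fun x => J (f x)) where
  smooth ξ := (hJ.smooth ξ).comp hf
  contract ξ x := by
    rw [← hJ.contract ξ (f x), ← mfderiv_fundamentalField (hf.mdifferentiable (by simp)) hfG]
    rfl

end Action

/-! ### Energy hypersurfaces -/

section EnergyHypersurface

variable {E : Type*} [NormedAddCommGroup E] [NormedSpace ℝ E] [FiniteDimensional ℝ E]
  {P : Type*} [TopologicalSpace P] [ChartedSpace E P] [IsManifold 𝓘(ℝ, E) ∞ P]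

/-- Since `dη = i^* dθ`, the contact condition at a point is a statement about the hyperplane
`ker dh` in the symplectic tangent space of `P`. -/
theorem IsEnergyHypersurface.isContactForm {θ : OneForm E P} {X : VecField E P} {h : P → ℝ}
    (hsys : IsExactHamiltonianSystem θ X h) {c : ℝ}
    {E' : Type*} [NormedAddCommGroup E'] [NormedSpace ℝ E']
    [ChartedSpace E' (h ⁻¹' {c})] [IsManifold 𝓘(ℝ, E') ∞ (h ⁻¹' {c})]
    (hS : IsEnergyHypersurface (E' := E') X h c) :
    IsContactForm (OneForm.pullback (E' := E') (Subtype.val : h ⁻¹' {c} → P) θ) where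
  smooth := hsys.exactSymplectic.smooth.pullback hS.embedded.contMDiff
  volume x := by
    have hi := hS.embedded.contMDiff
    have hid := hi.mdifferentiable (by simp) x
    have hhd := hsys.smooth.mdifferentiable (by simp) x.1
    rw [hsys.exactSymplectic.smooth.extD_pullback hi]
    have : FiniteDimensional ℝ (TangentSpace 𝓘(ℝ, E) x.1) :=
      inferInstanceAs (FiniteDimensional ℝ E)
    let l : TangentSpace 𝓘(ℝ, E) x.1 →L[ℝ] ℝ := mfderiv 𝓘(ℝ, E) 𝓘(ℝ, ℝ) h x.1
    refine exists_wedgePow_pullback_ne_zero (θ.extD x.1) (fun u hu => ?_) (θ x.1) (X x.1)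
      (hsys.liouville.contract x.1) l.toLinearMap (fun h0 => ?_) _
      (hS.embedded.isImmersion.isImmersionAt x).injective_mfderiv (fun t => ?_) (hS.transverse x)
    · refine hsys.exactSymplectic.nondegenerate x.1 u fun v => ?_
      simp [sympForm, hu v]
    · obtain ⟨v, hv⟩ := hS.regular x.1 x.2 (1 : ℝ)
      exact zero_ne_one ((DFunLike.congr_fun h0 v).symm.trans hv)
    · have h1 := mfderiv_comp_apply x hhd hid t
      have h2 : (h ∘ (Subtype.val : h ⁻¹' {c} → P)) = fun _ => c := funext fun y => y.2
      rw [h2, mfderiv_const] at h1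
      exact h1.symm

end EnergyHypersurface

theorem mainTheorem3
    {F : Type*} [NormedAddCommGroup F] [NormedSpace ℝ F] [FiniteDimensional ℝ F]
    {G : Type*} [TopologicalSpace G] [T2Space G] [ParacompactSpace G] [ChartedSpace F G]
    [Group G] [LieGroup 𝓘(ℝ, F) ∞ G]
    {E : Type*} [NormedAddCommGroup E] [NormedSpace ℝ E] [FiniteDimensional ℝ E]
    {P : Type*} [TopologicalSpace P] [T2Space P] [ParacompactSpace P] [ChartedSpace E P]
    [IsManifold 𝓘(ℝ, E) ∞ P]
    [MulAction G P] [ContMDiffSMul 𝓘(ℝ, F) 𝓘(ℝ, E) ∞ G P]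
    (θ : OneForm E P) (X : VecField E P) (h : P → ℝ)
    (hsys : IsExactHamiltonianSystem θ X h)
    (hθ : IsInvariantForm G θ)
    (hinv : ∀ (g : G) (p : P), h (g • p) = h p)
    (c : ℝ)
    {E' : Type*} [NormedAddCommGroup E'] [NormedSpace ℝ E'] [FiniteDimensional ℝ E']
    [ChartedSpace E' (h ⁻¹' {c})] [IsManifold 𝓘(ℝ, E') ∞ (h ⁻¹' {c})]
    (hS : IsEnergyHypersurface (E' := E') X h c)
    (J : P → Module.Dual ℝ (GroupLieAlgebra 𝓘(ℝ, F) G))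
    (hJ : IsMomentumMap θ J) :
    ∃ _ : MulAction G (h ⁻¹' {c}),
      (∀ (g : G) (x : h ⁻¹' {c}), ((g • x : h ⁻¹' {c}) : P) = g • (x : P)) ∧
      IsContactAction F G
        (OneForm.pullback (E' := E') (Subtype.val : h ⁻¹' {c} → P) θ) ∧
      IsMomentumMap (G := G)
        (OneForm.pullback (E' := E') (Subtype.val : h ⁻¹' {c} → P) θ)
        (fun x : h ⁻¹' {c} => J x) := by
  let act : MulAction G (h ⁻¹' {c}) :=
    { smul := fun g x => ⟨g • x.1, (hinv g x.1).trans x.2⟩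
      one_smul := fun x => Subtype.ext (one_smul G x.1)
      mul_smul := fun g g' x => Subtype.ext (mul_smul g g' x.1) }
  have hact : ∀ (g : G) (x : h ⁻¹' {c}), ((g • x : h ⁻¹' {c}) : P) = g • (x : P) := fun _ _ => rfl
  have hi := hS.embedded.contMDiff
  have hval : ContMDiff (𝓘(ℝ, F).prod 𝓘(ℝ, E')) 𝓘(ℝ, E) ∞
      (fun p : G × h ⁻¹' {c} => p.1 • (p.2 : P)) :=
    (ContMDiffSMul.contMDiff_smul (I := 𝓘(ℝ, F)) (I' := 𝓘(ℝ, E))).comp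
      (contMDiff_fst.prodMk (hi.comp contMDiff_snd))
  -- A continuous map into an embedded submanifold is smooth if it is so into the ambient manifold.
  have hsmooth : ContMDiffSMul 𝓘(ℝ, F) 𝓘(ℝ, E') ∞ G (h ⁻¹' {c}) :=
    ⟨(ContMDiff.iff_comp_isImmersion hS.embedded.isImmersion).2
      ⟨hS.embedded.isEmbedding.continuous_iff.2 hval.continuous, hval⟩⟩
  exact ⟨act, hact, ⟨hS.isContactForm hsys, hsmooth,
    hθ.pullback F (hi.mdifferentiable (by simp)) hact⟩, hJ.pullback hi hact⟩
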